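/- Let $(M^m,g)$, $(N^n,h)$, $(Q^l,k)$ be smooth Riemannian manifolds (without boundary) with Laplace--Beltrami operators $\Delta^M,\Delta^N,\Delta^Q$, and let $f:M\to(0,\infty)$ be a smooth function. A $C^2$ function $u$ on an open subset of a Riemannian manifold is harmonic if its Laplacian vanishes; a $C^2$ function $u$ on an open subset of $M$ is $f$-harmonic if $f\,\Delta^M u+g(\operatorname{grad} f,\operatorname{grad} u)=0$ there. A continuous map between Riemannian manifolds is a harmonic morphism (respectively, when its domain is $M$, an $f$-harmonic morphism) if for every harmonic function $u$ on an open subset $V$ of the target whose preimage is non-empty, the composition of $u$ with the map is harmonic (respectively $f$-harmonic) on the preimage of $V$. A $C^1$ map $\varphi:(M,g)\to(N,h)$ is horizontally weakly conformal with dilation $\lambda:M\to[0,\infty)$ if, for every $x\in M$, either $d\varphi_x=0$ and $\lambda(x)=0$, or $d\varphi_x\neq0$, $\lambda(x)>0$, and the restriction of $d\varphi_x$ to $H_x=(\ker d\varphi_x)^{\perp}$ is onto $T_{\varphi(x)}N$ and satisfies $h(d\varphi_x X,d\varphi_x Y)=\lambda(x)^2g(X,Y)$ for all $X,Y\in H_x$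 (and similarly for maps between other Riemannian manifolds). A harmonic or $f$-harmonic morphism has dilation $\lambda$ if it is horizontally weakly conformal with dilation $\lambda$. Let $\phi:(M,g)\to(N,h)$ be an $f$-harmonic morphism with dilation $\lambda_1$, and let $\psi:(N,h)\to(Q,k)$ be a harmonic morphism with dilation $\lambda_2$. Then $\psi\circ\phi:(M,g)\to(Q,k)$ is an $f$-harmonic morphism with dilation $\lambda_1\,(\lambda_2\circ\phi)$. -/

import Mathlib

open scoped Manifold ContDiff

noncomputable section

namespace RiemannianMorphism

/-- A smooth Riemannian metric on the `m`-dimensional smooth manifold `M`. -/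
abbrev SmoothMetric (m : ℕ) (M : Type*) [TopologicalSpace M]
    [ChartedSpace (EuclideanSpace ℝ (Fin m)) M] [IsManifold (𝓡 m) ∞ M] :=
  Bundle.ContMDiffRiemannianMetric (𝓡 m) ∞ (EuclideanSpace ℝ (Fin m))
    (fun x : M => TangentSpace (𝓡 m) x)

section Operators

variable {m : ℕ} {M : Type*} [TopologicalSpace M]
  [ChartedSpace (EuclideanSpace ℝ (Fin m)) M] [IsManifold (𝓡 m) ∞ M]

/-- The differential of a real function `u` at `x`, as a covector. -/
def differential (u : M → ℝ) (x : M) : TangentSpace (𝓡 m) x →L[ℝ] ℝ :=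
  mfderiv (𝓡 m) 𝓘(ℝ, ℝ) u x

/-- Riesz representation: every covector at `x` is `g(v, ·)` for some tangent vector `v`. -/
theorem exists_inner_eq (g : SmoothMetric m M) (x : M) (α : TangentSpace (𝓡 m) x →L[ℝ] ℝ) :
    ∃ v : TangentSpace (𝓡 m) x, ∀ w : TangentSpace (𝓡 m) x, g.inner x v w = α w := by
  let T := EuclideanSpace ℝ (Fin m)
  let B : T →ₗ[ℝ] (T →ₗ[ℝ] ℝ) :=
    { toFun := fun v => (g.inner x v).toLinearMap
      map_add' := by intro v w; ext z; exact congrArg (fun L => L z) ((g.inner x).map_add v w)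
      map_smul' := by intro c v; ext z; exact congrArg (fun L => L z) ((g.inner x).map_smul c v) }
  have hinj : Function.Injective B := by
    rw [injective_iff_map_eq_zero]
    intro v hv
    by_contra hne
    have h1 : 0 < g.inner x v v := g.pos x v hne
    have h2 : g.inner x v v = 0 := congrArg (fun L => L v) hv
    exact absurd h2 h1.ne'
  have hsurj : Function.Surjective B :=
    (LinearMap.injective_iff_surjective_of_finrank_eq_finrank
      (Subspace.dual_finrank_eq (K := ℝ) (V := T)).symm).1 hinj
  obtain ⟨v, hv⟩ := hsurj α.toLinearMap
  exact ⟨v, fun w => congrArg (fun L => L w) hv⟩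

/-- The gradient of `u` at `x`: the tangent vector with `g(grad u, w) = du(w)` for all `w`. -/
def grad (g : SmoothMetric m M) (u : M → ℝ) (x : M) : TangentSpace (𝓡 m) x :=
  Classical.choose (exists_inner_eq g x (differential u x))

theorem inner_grad (g : SmoothMetric m M) (u : M → ℝ) (x : M) (w : TangentSpace (𝓡 m) x) :
    g.inner x (grad g u x) w = differential u x w :=
  Classical.choose_spec (exists_inner_eq g x (differential u x)) w

/-- The `i`-th partial derivative in `ℝ^m`. -/
def partialDeriv (i : Fin m) (F : EuclideanSpace ℝ (Fin m) → ℝ)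
    (y : EuclideanSpace ℝ (Fin m)) : ℝ :=
  fderiv ℝ F y (EuclideanSpace.single i 1)

/-- The coordinate vector field `∂ᵢ` of the chart at `x`, at the point with coordinates `y`. -/
def coordVector (x : M) (i : Fin m) (y : EuclideanSpace ℝ (Fin m)) :
    TangentSpace (𝓡 m) ((extChartAt (𝓡 m) x).symm y) :=
  mfderiv 𝓘(ℝ, EuclideanSpace ℝ (Fin m)) (𝓡 m) (extChartAt (𝓡 m) x).symm y
    (EuclideanSpace.single i (1 : ℝ) : EuclideanSpace ℝ (Fin m))

/-- The matrix `gᵢⱼ = g(∂ᵢ, ∂ⱼ)` of the metric in the chart at `x`, as a function of the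
coordinates `y`. -/
def metricMatrix (g : SmoothMetric m M) (x : M) (y : EuclideanSpace ℝ (Fin m)) :
    Matrix (Fin m) (Fin m) ℝ :=
  Matrix.of fun i j =>
    g.inner ((extChartAt (𝓡 m) x).symm y) (coordVector x i y) (coordVector x j y)

/-- The Laplace-Beltrami operator, `Δu = |g|^(-1/2) ∑ᵢⱼ ∂ᵢ (|g|^(1/2) gⁱʲ ∂ⱼ u)`, evaluated at `x`
in the chart at `x` (for a `C²` function the value does not depend on the chart). -/
def laplaceBeltrami (g : SmoothMetric m M) (u : M → ℝ) (x : M) : ℝ :=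
  (√(metricMatrix g x (extChartAt (𝓡 m) x x)).det)⁻¹ *
    ∑ i, ∑ j, partialDeriv i
      (fun y => √(metricMatrix g x y).det * (metricMatrix g x y)⁻¹ i j *
        partialDeriv j (u ∘ (extChartAt (𝓡 m) x).symm) y)
      (extChartAt (𝓡 m) x x)

/-- `u` is a (`C²`) harmonic function on the open set `U`; only the values of `u` on `U` matter. -/
structure IsHarmonicFunctionOn (g : SmoothMetric m M) (u : M → ℝ) (U : Set M) : Prop where
  contMDiffOn : ContMDiffOn (𝓡 m) 𝓘(ℝ, ℝ) 2 u U
  laplace_eq_zero : ∀ x ∈ U, laplaceBeltrami g u x = 0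

/-- `u` is a (`C²`) `f`-harmonic function on the open set `U`: `f Δu + g(grad f, grad u) = 0`. -/
structure IsFHarmonicFunctionOn (g : SmoothMetric m M) (f u : M → ℝ) (U : Set M) : Prop where
  contMDiffOn : ContMDiffOn (𝓡 m) 𝓘(ℝ, ℝ) 2 u U
  f_laplace_eq_zero : ∀ x ∈ U,
    f x * laplaceBeltrami g u x + g.inner x (grad g f x) (grad g u x) = 0

end Operators

section Maps

variable {m n : ℕ} {M N : Type*}
  [TopologicalSpace M] [ChartedSpace (EuclideanSpace ℝ (Fin m)) M] [IsManifold (𝓡 m) ∞ M]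
  [TopologicalSpace N] [ChartedSpace (EuclideanSpace ℝ (Fin n)) N] [IsManifold (𝓡 n) ∞ N]

/-- A harmonic morphism: a continuous map that pulls back local harmonic functions to harmonic
functions. -/
structure IsHarmonicMorphism (g : SmoothMetric m M) (h : SmoothMetric n N) (φ : M → N) :
    Prop where
  continuous : Continuous φ
  comp_harmonic : ∀ (V : Set N) (u : N → ℝ), IsOpen V → (φ ⁻¹' V).Nonempty →
    IsHarmonicFunctionOn h u V → IsHarmonicFunctionOn g (u ∘ φ) (φ ⁻¹' V)

/-- An `f`-harmonic morphism: a continuous map that pulls back local harmonic functions to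
`f`-harmonic functions. -/
structure IsFHarmonicMorphism (g : SmoothMetric m M) (h : SmoothMetric n N) (f : M → ℝ)
    (φ : M → N) : Prop where
  continuous : Continuous φ
  comp_fHarmonic : ∀ (V : Set N) (u : N → ℝ), IsOpen V → (φ ⁻¹' V).Nonempty →
    IsHarmonicFunctionOn h u V → IsFHarmonicFunctionOn g f (u ∘ φ) (φ ⁻¹' V)

/-- The vertical space `V_x = ker dφ_x`. -/
def verticalSpace (φ : M → N) (x : M) : Set (TangentSpace (𝓡 m) x) :=
  {v | mfderiv (𝓡 m) (𝓡 n) φ x v = 0}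

/-- The horizontal space `H_x`, the `g`-orthogonal complement of `V_x` in `T_x M`. -/
def horizontalSpace (g : SmoothMetric m M) (φ : M → N) (x : M) :
    Set (TangentSpace (𝓡 m) x) :=
  {w | ∀ v ∈ verticalSpace (m := m) (n := n) φ x, g.inner x w v = 0}

/-- `φ` is a horizontally weakly conformal (`C¹`) map and `lam : M → [0, ∞)` is its dilation:
where `dφ_x ≠ 0`, the restriction of `dφ_x` to `H_x` is surjective and conformal with factor
`lam x > 0`; where `dφ_x = 0`, `lam x = 0`. -/
structure IsHorizontallyWeaklyConformalWithDilation (g : SmoothMetric m M) (h : SmoothMetric n N)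
    (φ : M → N) (lam : M → ℝ) : Prop where
  contMDiff : ContMDiff (𝓡 m) (𝓡 n) 1 φ
  eq_zero : ∀ x, mfderiv (𝓡 m) (𝓡 n) φ x = 0 → lam x = 0
  pos : ∀ x, mfderiv (𝓡 m) (𝓡 n) φ x ≠ 0 → 0 < lam x
  conformal : ∀ x, mfderiv (𝓡 m) (𝓡 n) φ x ≠ 0 →
    ∀ v ∈ horizontalSpace (n := n) g φ x, ∀ w ∈ horizontalSpace (n := n) g φ x,
      h.inner (φ x) (mfderiv (𝓡 m) (𝓡 n) φ x v) (mfderiv (𝓡 m) (𝓡 n) φ x w) =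
        lam x ^ 2 * g.inner x v w
  surjOn : ∀ x, mfderiv (𝓡 m) (𝓡 n) φ x ≠ 0 →
    Set.SurjOn (mfderiv (𝓡 m) (𝓡 n) φ x) (horizontalSpace (n := n) g φ x) Set.univ

end Maps

end RiemannianMorphism

end

namespace RiemannianMorphism

variable {m n l : ℕ} {M N Q : Type*}
  [TopologicalSpace M] [ChartedSpace (EuclideanSpace ℝ (Fin m)) M] [IsManifold (𝓡 m) ∞ M]
  [TopologicalSpace N] [ChartedSpace (EuclideanSpace ℝ (Fin n)) N] [IsManifold (𝓡 n) ∞ N]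
  [TopologicalSpace Q] [ChartedSpace (EuclideanSpace ℝ (Fin l)) Q] [IsManifold (𝓡 l) ∞ Q]

/-! The morphism half is formal: pulling back along `ψ` keeps a local function harmonic, and pulling
back along `φ` then makes it `f`-harmonic. The dilation half is linear algebra at a point, via the
chain rule. Where `dφ_x ≠ 0`, `dφ_x` maps `H_x` onto the whole tangent space and scales inner
products there by `lam₁ x ^ 2`, so it preserves and reflects orthogonality. Hence a vector is
horizontal for `ψ ∘ φ` exactly when it is `φ`-horizontal with `ψ`-horizontal image
(`mem_horizontalSpace_of_comp`, `mfderiv_mem_horizontalSpace`, `mem_horizontalSpace_comp`). On such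
vectors the two conformal factors multiply. -/

/-- An `f`-harmonic morphism followed by a harmonic morphism is an `f`-harmonic morphism. -/
theorem IsHarmonicMorphism.comp_isFHarmonicMorphism {g : SmoothMetric m M} {h : SmoothMetric n N}
    {k : SmoothMetric l Q} {f : M → ℝ} {φ : M → N} {ψ : N → Q}
    (hψ : IsHarmonicMorphism h k ψ) (hφ : IsFHarmonicMorphism g h f φ) :
    IsFHarmonicMorphism g k f (ψ ∘ φ) where
  continuous := hψ.continuous.comp hφ.continuous
  comp_fHarmonic V u hV hne hu := by
    have hne' : (ψ ⁻¹' V).Nonempty := hne.imp' φ fun _ hx => hx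
    exact hφ.comp_fHarmonic (ψ ⁻¹' V) (u ∘ ψ) (hV.preimage hψ.continuous) hne
      (hψ.comp_harmonic V u hV hne' hu)

namespace IsHorizontallyWeaklyConformalWithDilation

variable {g : SmoothMetric m M} {h : SmoothMetric n N} {k : SmoothMetric l Q}
  {φ : M → N} {ψ : N → Q} {lam₁ : M → ℝ} {lam₂ : N → ℝ}

theorem mfderiv_comp_apply (hφ : IsHorizontallyWeaklyConformalWithDilation g h φ lam₁)
    (hψ : IsHorizontallyWeaklyConformalWithDilation h k ψ lam₂) (x : M)
    (v : TangentSpace (𝓡 m) x) :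
    mfderiv (𝓡 m) (𝓡 l) (ψ ∘ φ) x v =
      mfderiv (𝓡 n) (𝓡 l) ψ (φ x) (mfderiv (𝓡 m) (𝓡 n) φ x v) :=
  _root_.mfderiv_comp_apply x (hψ.contMDiff.mdifferentiableAt one_ne_zero)
    (hφ.contMDiff.mdifferentiableAt one_ne_zero) v

theorem mfderiv_left_ne_zero (hφ : IsHorizontallyWeaklyConformalWithDilation g h φ lam₁)
    (hψ : IsHorizontallyWeaklyConformalWithDilation h k ψ lam₂) {x : M}
    (hx : mfderiv (𝓡 m) (𝓡 l) (ψ ∘ φ) x ≠ 0) : mfderiv (𝓡 n) (𝓡 l) ψ (φ x) ≠ 0 := by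
  contrapose! hx
  ext1 v
  rw [hφ.mfderiv_comp_apply hψ, hx]
  rfl

theorem mfderiv_right_ne_zero (hφ : IsHorizontallyWeaklyConformalWithDilation g h φ lam₁)
    (hψ : IsHorizontallyWeaklyConformalWithDilation h k ψ lam₂) {x : M}
    (hx : mfderiv (𝓡 m) (𝓡 l) (ψ ∘ φ) x ≠ 0) : mfderiv (𝓡 m) (𝓡 n) φ x ≠ 0 := by
  contrapose! hx
  ext1 v
  rw [hφ.mfderiv_comp_apply hψ, hx]
  exact map_zero (mfderiv (𝓡 n) (𝓡 l) ψ (φ x))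

/-- Horizontal vectors of a composition are horizontal for the inner map. -/
theorem mem_horizontalSpace_of_comp (hφ : IsHorizontallyWeaklyConformalWithDilation g h φ lam₁)
    (hψ : IsHorizontallyWeaklyConformalWithDilation h k ψ lam₂) {x : M}
    {w : TangentSpace (𝓡 m) x} (hw : w ∈ horizontalSpace (n := l) g (ψ ∘ φ) x) :
    w ∈ horizontalSpace (n := n) g φ x := by
  intro v (hv : mfderiv (𝓡 m) (𝓡 n) φ x v = 0)
  refine hw v ?_
  change mfderiv (𝓡 m) (𝓡 l) (ψ ∘ φ) x v = 0
  rw [hφ.mfderiv_comp_apply hψ, hv]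
  exact map_zero (mfderiv (𝓡 n) (𝓡 l) ψ (φ x))

/-- The inner differential maps horizontal vectors of a composition to horizontal vectors of the
outer map. -/
theorem mfderiv_mem_horizontalSpace (hφ : IsHorizontallyWeaklyConformalWithDilation g h φ lam₁)
    (hψ : IsHorizontallyWeaklyConformalWithDilation h k ψ lam₂) {x : M}
    (hx : mfderiv (𝓡 m) (𝓡 n) φ x ≠ 0) {w : TangentSpace (𝓡 m) x}
    (hw : w ∈ horizontalSpace (n := l) g (ψ ∘ φ) x) :
    mfderiv (𝓡 m) (𝓡 n) φ x w ∈ horizontalSpace (n := l) h ψ (φ x) := by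
  intro v (hv : mfderiv (𝓡 n) (𝓡 l) ψ (φ x) v = 0)
  -- Conformality of `φ` applies only to horizontal vectors, so `v` is lifted to a horizontal `v'`,
  -- which lies in the kernel of `d(ψ ∘ φ)` and is thus orthogonal to `w`.
  obtain ⟨v', hv', rfl⟩ := hφ.surjOn x hx (Set.mem_univ v)
  rw [hφ.conformal x hx w (hφ.mem_horizontalSpace_of_comp hψ hw) v' hv',
    hw v' ((hφ.mfderiv_comp_apply hψ x v').trans hv), mul_zero]

/-- A `φ`-horizontal vector whose image is `ψ`-horizontal is horizontal for `ψ ∘ φ`. -/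
theorem mem_horizontalSpace_comp (hφ : IsHorizontallyWeaklyConformalWithDilation g h φ lam₁)
    (hψ : IsHorizontallyWeaklyConformalWithDilation h k ψ lam₂) {x : M}
    (hx : mfderiv (𝓡 m) (𝓡 n) φ x ≠ 0) {w : TangentSpace (𝓡 m) x}
    (hw : w ∈ horizontalSpace (n := n) g φ x)
    (hφw : mfderiv (𝓡 m) (𝓡 n) φ x w ∈ horizontalSpace (n := l) h ψ (φ x)) :
    w ∈ horizontalSpace (n := l) g (ψ ∘ φ) x := by
  intro v (hv : mfderiv (𝓡 m) (𝓡 l) (ψ ∘ φ) x v = 0)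
  rw [hφ.mfderiv_comp_apply hψ] at hv
  -- `v'` serves as the `φ`-horizontal part of `v`: the difference is `φ`-vertical, so `w` pairs
  -- equally with both.
  obtain ⟨v', hv', hvv'⟩ := hφ.surjOn x hx (Set.mem_univ (mfderiv (𝓡 m) (𝓡 n) φ x v))
  have hker : v - v' ∈ verticalSpace (n := n) φ x := by
    change mfderiv (𝓡 m) (𝓡 n) φ x (v - v') = 0
    exact (map_sub (mfderiv (𝓡 m) (𝓡 n) φ x) v v').trans (sub_eq_zero.2 hvv'.symm)
  have hvert : g.inner x w v - g.inner x w v' = 0 :=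
    (map_sub (g.inner x w) v v').symm.trans (hw _ hker)
  have hhor : lam₁ x ^ 2 * g.inner x w v' = 0 := by
    rw [← hφ.conformal x hx w hw v' hv', hvv']
    exact hφw _ hv
  rw [sub_eq_zero.1 hvert]
  exact (mul_eq_zero.1 hhor).resolve_left (pow_pos (hφ.pos x hx) 2).ne'

/-- Horizontally weakly conformal maps compose, and their dilations multiply. -/
theorem comp (hψ : IsHorizontallyWeaklyConformalWithDilation h k ψ lam₂)
    (hφ : IsHorizontallyWeaklyConformalWithDilation g h φ lam₁) :
    IsHorizontallyWeaklyConformalWithDilation g k (ψ ∘ φ) (fun x => lam₁ x * lam₂ (φ x)) where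
  contMDiff := hψ.contMDiff.comp hφ.contMDiff
  eq_zero x hx := by
    by_cases hφx : mfderiv (𝓡 m) (𝓡 n) φ x = 0
    · rw [hφ.eq_zero x hφx, zero_mul]
    -- A nonzero `dφ_x` is onto, so the composite differential can vanish only if `dψ` does.
    · have hψx : mfderiv (𝓡 n) (𝓡 l) ψ (φ x) = 0 := by
        ext1 v
        obtain ⟨v', -, rfl⟩ := hφ.surjOn x hφx (Set.mem_univ v)
        rw [← hφ.mfderiv_comp_apply hψ, hx]
        rfl
      rw [hψ.eq_zero _ hψx, mul_zero]
  pos x hx := mul_pos (hφ.pos x (hφ.mfderiv_right_ne_zero hψ hx))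
    (hψ.pos _ (hφ.mfderiv_left_ne_zero hψ hx))
  conformal x hx v hv w hw := by
    have hφx := hφ.mfderiv_right_ne_zero hψ hx
    rw [hφ.mfderiv_comp_apply hψ, hφ.mfderiv_comp_apply hψ]
    refine (hψ.conformal _ (hφ.mfderiv_left_ne_zero hψ hx) _
      (hφ.mfderiv_mem_horizontalSpace hψ hφx hv) _
      (hφ.mfderiv_mem_horizontalSpace hψ hφx hw)).trans ?_
    rw [hφ.conformal x hφx v (hφ.mem_horizontalSpace_of_comp hψ hv) w
      (hφ.mem_horizontalSpace_of_comp hψ hw)]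
    ring
  surjOn x hx z hz := by
    have hφx := hφ.mfderiv_right_ne_zero hψ hx
    -- Two successive horizontal lifts, through `ψ` and then `φ`, give a preimage horizontal for the
    -- composition.
    obtain ⟨y, hy, rfl⟩ := hψ.surjOn _ (hφ.mfderiv_left_ne_zero hψ hx) hz
    obtain ⟨w, hw, rfl⟩ := hφ.surjOn x hφx (Set.mem_univ y)
    exact ⟨w, hφ.mem_horizontalSpace_comp hψ hφx hw hy, hφ.mfderiv_comp_apply hψ x w⟩

end IsHorizontallyWeaklyConformalWithDilation

end RiemannianMorphism

open RiemannianMorphism in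
theorem mainTheorem12 {m n l : ℕ} {M N Q : Type*}
    [TopologicalSpace M] [ChartedSpace (EuclideanSpace ℝ (Fin m)) M] [IsManifold (𝓡 m) ∞ M]
    [TopologicalSpace N] [ChartedSpace (EuclideanSpace ℝ (Fin n)) N] [IsManifold (𝓡 n) ∞ N]
    [TopologicalSpace Q] [ChartedSpace (EuclideanSpace ℝ (Fin l)) Q] [IsManifold (𝓡 l) ∞ Q]
    (g : SmoothMetric m M) (h : SmoothMetric n N) (k : SmoothMetric l Q)
    (f : M → ℝ) (hf : ContMDiff (𝓡 m) 𝓘(ℝ, ℝ) ∞ f) (hfpos : ∀ x, 0 < f x)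
    (φ : M → N) (ψ : N → Q) (lam₁ : M → ℝ) (lam₂ : N → ℝ)
    (hφ : IsFHarmonicMorphism g h f φ)
    (hφlam : IsHorizontallyWeaklyConformalWithDilation g h φ lam₁)
    (hψ : IsHarmonicMorphism h k ψ)
    (hψlam : IsHorizontallyWeaklyConformalWithDilation h k ψ lam₂) :
    IsFHarmonicMorphism g k f (ψ ∘ φ) ∧
      IsHorizontallyWeaklyConformalWithDilation g k (ψ ∘ φ)
        (fun x => lam₁ x * lam₂ (φ x)) :=
  ⟨hψ.comp_isFHarmonicMorphism hφ, hψlam.comp hφlam⟩
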